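/- Let $(A,\mathfrak m)$ be a regular local ring of dimension $3$ containing $\mathbb R$ and with residue field $A/\mathfrak m=\mathbb R$, and let $u=(u_1,u_2,u_3)$ be a regular system of parameters of $A$. A point $\alpha\in\operatorname{Sper}A$ is a prime ideal $\mathfrak p_\alpha$ with a total ordering of the field of fractions $A(\alpha)$ of $A/\mathfrak p_\alpha$; $\nu_\alpha$ denotes the valuation of $A(\alpha)$ whose valuation ring consists of the elements bounded in absolute value by an element of $A/\mathfrak p_\alpha$ (with $\nu_\alpha(f)=\infty$ for $f\in\mathfrak p_\alpha$), and $\operatorname{in}_\alpha$ denotes initial forms with respect to $\nu_\alpha$. The point $\alpha$ is centered at $\mathfrak m$ if $\mathfrak m=\{f\in A:\nu_\alpha(f)>0\}$. For $\alpha,\beta\in\operatorname{Sper}A$ the separating ideal $\langle\alpha,\beta\rangle$ is the ideal generated by all $f\in A$ with $f(\alpha)\ge0$ and $f(\beta)\le0$. Approximate roots. Fix a monomial order on $\mathbb N^3$ (for instance the lexicographical one). A system of approximate roots of $\nu_\alpha$ up to $\gamma$ (an element of the value group or $\infty$) is a countable well-ordered set $\{Q_i\}$ of elements of $A$, starting with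 $u_1,u_2,u_3$, such that every $\nu_\alpha$-ideal of value less than $\gamma$ is generated by the generalized monomials $\mathbf Q^\delta=\prod_j Q_j^{\delta_j}$ that it contains, and such that every further $Q_i$ comes with an expression $$Q_i=Ex(Q_i)=\mathbf Q^{\eta}-\sum_{\varepsilon}c_\varepsilon\mathbf Q^{\varepsilon},\qquad c_\varepsilon\in\mathbb R,$$ a finite sum in generalized monomials in the preceding roots, where $\nu_\alpha(Q_i)>\nu_\alpha(\mathbf Q^\eta)=\nu_\alpha(\mathbf Q^\varepsilon)$ and $\varepsilon<\eta$ for all $\varepsilon$ that occur, for a monomial order on exponents that extends the given one; here the $\mathbf Q^\varepsilon$ and all proper divisors $\mathbf Q^{\delta}$ of $\mathbf Q^\eta$ are standard, that is, their initial forms are not $\mathbb R$-linear combinations of the initial forms of smaller generalized monomials of the same value in the roots preceding $Q_i$. A root has complexity $0$ if it is one of $u_1,u_2,u_3$, and it has complexity $1$ if it is not one of them and only (and at least one of) $u_1,u_2,u_3$ appear in $Ex(Q)$. A root of complexity $1$ is common to $\alpha$ and $\beta$ if it belongs, with the same expression, to a given system for $\alpha$ and to a given system for $\beta$. Comparability.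 A root of complexity $1$ is a binomial $Q=u^\eta-\lambda u^\theta$ with $\lambda\in\mathbb R\setminus\{0\}$ and initial monomial $u^\eta$; put $Q'=\dfrac{u^\eta}{u^\theta}-\lambda$. Two common roots $Q_i,Q_j$ of complexity $1$ not in $\langle\alpha,\beta\rangle$ are called $(\alpha,\beta)$-comparable if one of the following holds: - $\nu_\alpha(Q_i')<\nu_\alpha(Q_j')$ and $\nu_\beta(Q_i')<\nu_\beta(Q_j')$; - $\nu_\alpha(Q_i')>\nu_\alpha(Q_j')$ and $\nu_\beta(Q_i')>\nu_\beta(Q_j')$; - $\nu_\alpha(Q_i')=\nu_\alpha(Q_j')$, $\nu_\beta(Q_i')=\nu_\beta(Q_j')$ and $\dfrac{\operatorname{in}_\alpha Q_i'}{\operatorname{in}_\alpha Q_j'}=\dfrac{\operatorname{in}_\beta Q_i'}{\operatorname{in}_\beta Q_j'}$ (as real numbers). Lemma 6.6. Let $\alpha,\beta\in\operatorname{Sper}A$ be centered at $\mathfrak m$, and let $Q_4,Q_5,Q_6$ be three distinct approximate roots of complexity $1$ common to $\alpha$ and $\beta$, none of which belongs to $\langle\alpha,\beta\rangle$. Then $Q_4,Q_5,Q_6$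 are either pairwise $(\alpha,\beta)$-comparable or pairwise not $(\alpha,\beta)$-comparable. -/

import Mathlib

open MvPolynomial

noncomputable section

/-- A point of the real spectrum of `A`: a prime ideal (the support) together with a total ordering
of the field of fractions of the quotient, compatible with the field operations. -/
structure SperPoint (A : Type*) [CommRing A] where
  supp : Ideal A
  isPrime : supp.IsPrime
  order : LinearOrder (FractionRing (A ⧸ supp))
  ordered : IsStrictOrderedRing (FractionRing (A ⧸ supp))

namespace SperPoint

variable {A : Type*} [CommRing A]

instance (α : SperPoint A) : α.supp.IsPrime := α.isPrime

/-- The field `A(α)`. -/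
abbrev K (α : SperPoint A) : Type _ := FractionRing (A ⧸ α.supp)

instance (α : SperPoint A) : LinearOrder α.K := α.order

instance (α : SperPoint A) : IsStrictOrderedRing α.K := α.ordered

/-- The value `f(α)` of `f ∈ A` at the point `α`, that is, the natural map `A → A(α)`. -/
def eval (α : SperPoint A) : A →+* α.K :=
  (algebraMap (A ⧸ α.supp) α.K).comp (Ideal.Quotient.mk α.supp)

/-- The valuation ring of `α`: the elements of `A(α)` whose absolute value is bounded by an element
of the image of `A`, i.e. the convex hull of `A / supp α` in `A(α)`. -/
def valuationRing (α : SperPoint A) : ValuationSubring α.K where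
  carrier := {x | ∃ a : A, |x| ≤ α.eval a}
  mul_mem' := by
    rintro x y ⟨a, ha⟩ ⟨b, hb⟩
    refine ⟨a * b, ?_⟩
    rw [abs_mul, map_mul]
    exact mul_le_mul ha hb (abs_nonneg _) ((abs_nonneg _).trans ha)
  one_mem' := ⟨1, by simp⟩
  add_mem' := by
    rintro x y ⟨a, ha⟩ ⟨b, hb⟩
    refine ⟨a + b, ?_⟩
    rw [map_add]
    exact (abs_add_le x y).trans (add_le_add ha hb)
  zero_mem' := ⟨0, by simp⟩
  neg_mem' := by
    rintro x ⟨a, ha⟩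
    exact ⟨a, by rwa [abs_neg]⟩
  mem_or_inv_mem' := by
    intro x
    rcases le_total |x| 1 with h | h
    · exact Or.inl ⟨1, by simpa using h⟩
    · refine Or.inr ⟨1, ?_⟩
      rw [abs_inv, map_one]
      exact inv_le_one_of_one_le₀ h

/-- The value group of `α`, with a zero adjoined. It is written multiplicatively, with the order
reversed: `ν_α(x) < ν_α(y)` reads `α.val y < α.val x`, and `ν_α(x) = ∞` reads `α.val x = 0`. -/
abbrev ValueGroup (α : SperPoint A) : Type _ := α.valuationRing.ValueGroup

/-- The valuation `ν_α` of the field `A(α)`, in multiplicative notation. -/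
abbrev val (α : SperPoint A) : Valuation α.K α.ValueGroup := α.valuationRing.valuation

/-- The valuation `ν_α` on elements of `A`, in multiplicative notation. -/
def v (α : SperPoint A) (f : A) : α.ValueGroup := α.val (α.eval f)

/-- `ν_α` is centered at the maximal ideal: the elements of `A` of positive value are exactly those
of the maximal ideal. -/
def IsCentered [IsLocalRing A] (α : SperPoint A) : Prop :=
  ∀ f : A, α.v f < 1 ↔ f ∈ IsLocalRing.maximalIdeal A

/-- The separating ideal `⟨α, β⟩`, generated by the elements that change sign
between `α` and `β`. -/
def separatingIdeal (α β : SperPoint A) : Ideal A :=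
  Ideal.span {f | 0 ≤ α.eval f ∧ β.eval f ≤ 0}

/-- `x` and `y` have the same value, and their initial forms in the graded algebra of `ν_α` satisfy
`in_α x = c · in_α y` with `c` a real number; in other words `in_α x / in_α y = c`.
(The initial forms of `x` and `c y` are equal in `P_γ / P_{γ+}`, `γ = ν_α(y)`, when the difference
has value greater than `γ`.) -/
def InitialRatioEq [Algebra ℝ A] (α : SperPoint A) (x y : α.K) (c : ℝ) : Prop :=
  α.val x = α.val y ∧ α.val (x - α.eval (algebraMap ℝ A c) * y) < α.val y

end SperPoint

/-- The generalized monomial `∏ Q_j ^ δ_j`. -/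
def genMonomial {A ι : Type*} [CommRing A] (Q : ι → A) (δ : ι →₀ ℕ) : A :=
  δ.prod fun j e => Q j ^ e

section ApproximateRoots

variable {A : Type*} [CommRing A] [Algebra ℝ A]

/-- `lt` is a strict monomial order on exponents: a total order compatible with addition, for which
`0` is the smallest exponent. -/
structure IsExponentOrder {ι : Type*} (lt : (ι →₀ ℕ) → (ι →₀ ℕ) → Prop) : Prop where
  irrefl : ∀ δ, ¬ lt δ δ
  trans : ∀ δ ε ζ, lt δ ε → lt ε ζ → lt δ ζ
  total : ∀ δ ε, δ ≠ ε → lt δ ε ∨ lt ε δ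
  add_right : ∀ δ ε ζ, lt δ ε → lt (δ + ζ) (ε + ζ)
  zero_lt : ∀ δ, δ ≠ 0 → lt 0 δ

/-- The real polynomial `p` in the `Q_j` is a linear combination of generalized monomials that
involve only the `Q_j` with `j < i`, have the same value as `Q ^ δ`, and precede `Q ^ δ`:
generalized monomials are ordered by the pairs (value, exponent), first by the value and then by
the order `lt` of the exponents. -/
def IsCombinationOfSmaller (α : SperPoint A) {ι : Type*} [LinearOrder ι]
    (lt : (ι →₀ ℕ) → (ι →₀ ℕ) → Prop) (Q : ι → A) (i : ι)
    (δ : ι →₀ ℕ) (p : MvPolynomial ι ℝ) : Prop :=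
  ∀ ε ∈ p.support, (∀ j ∈ ε.support, j < i) ∧ lt ε δ ∧
    α.v (genMonomial Q ε) = α.v (genMonomial Q δ)

/-- `Q ^ δ` is standard with respect to the `Q_j`, `j < i`: its initial form is not a real linear
combination of initial forms of smaller generalized monomials of the same value. -/
def IsStandard (α : SperPoint A) {ι : Type*} [LinearOrder ι]
    (lt : (ι →₀ ℕ) → (ι →₀ ℕ) → Prop) (Q : ι → A) (i : ι)
    (δ : ι →₀ ℕ) : Prop :=
  ¬ ∃ p : MvPolynomial ι ℝ, IsCombinationOfSmaller α lt Q i δ p ∧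
    α.v (genMonomial Q δ - aeval Q p) < α.v (genMonomial Q δ)

/-- `p` is an admissible expression of a new approximate root coming after the `Q_j`, `j < i`.
It is a generalized monomial (the initial monomial) minus a linear combination of smaller standard
monomials of the same value, where the initial forms cancel, so that the value jumps; and the
initial monomial is minimal with respect to divisibility among the monomials that are
not standard. -/
def IsAdmissibleExpression (α : SperPoint A) {ι : Type*} [LinearOrder ι]
    (lt : (ι →₀ ℕ) → (ι →₀ ℕ) → Prop) (Q : ι → A) (i : ι)
    (p : MvPolynomial ι ℝ) : Prop :=
  ∃ (lead : ι →₀ ℕ) (tail : MvPolynomial ι ℝ),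
    p = monomial lead 1 - tail ∧
    (∀ j ∈ lead.support, j < i) ∧
    IsCombinationOfSmaller α lt Q i lead tail ∧
    (∀ ε ∈ tail.support, IsStandard α lt Q i ε) ∧
    α.v (aeval Q p) < α.v (genMonomial Q lead) ∧
    ∀ δ : ι →₀ ℕ, δ ≤ lead → δ ≠ lead → IsStandard α lt Q i δ

/-- A system of approximate roots of `ν_α` up to `γ` (an element of the value group, or `γ = ∞`,
i.e. `0` in multiplicative notation), starting with the given parameters `u_1, …, u_n`.
It is a countable well-ordered set of elements `Q_i` of `A`, each equipped with its expression
`Ex(Q_i)` as a sum of generalized monomials in the preceding roots. Exponents are compared by a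
monomial order (for instance the lexicographical one) which on the monomials in the parameters is
the given order `m`. -/
structure ApproximateRootSystem {n : ℕ} (m : MonomialOrder (Fin n)) (α : SperPoint A) (u : Fin n → A)
    (γ : α.ValueGroup) where
  ι : Type
  [linearOrder : LinearOrder ι]
  [wellFounded : WellFoundedLT ι]
  [countable : Countable ι]
  Q : ι → A
  Q_injective : Function.Injective Q
  /-- The expression `Ex(Q_i)`, a polynomial in (variables that stand for) the roots. -/
  Ex : ι → MvPolynomial ι ℝ
  /-- The positions of the parameters: they are the first `n` roots. -/
  idx : Fin n → ι
  idx_strictMono : StrictMono idx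
  idx_lt : ∀ i, i ∉ Set.range idx → ∀ k, idx k < i
  /-- The order of the exponents. -/
  lt : (ι →₀ ℕ) → (ι →₀ ℕ) → Prop
  isExponentOrder : IsExponentOrder lt
  lt_idx : ∀ a b : Fin n →₀ ℕ,
    lt (a.mapDomain idx) (b.mapDomain idx) ↔ m.toSyn a < m.toSyn b
  Q_idx : ∀ k, Q (idx k) = u k
  /-- Convention: a parameter is its own expression. -/
  Ex_idx : ∀ k, Ex (idx k) = X (idx k)
  Q_eq : ∀ i, Q i = aeval Q (Ex i)
  admissible : ∀ i, i ∉ Set.range idx → IsAdmissibleExpression α lt Q i (Ex i)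
  /-- Every `ν_α`-ideal of value less than `γ` is generated by the generalized monomials
  it contains. -/
  generates : ∀ g : A, γ < α.v g →
    {f : A | α.v f ≤ α.v g} =
      Ideal.span {h : A | ∃ δ : ι →₀ ℕ, h = genMonomial Q δ ∧ α.v h ≤ α.v g}

namespace ApproximateRootSystem

variable {n : ℕ} {m : MonomialOrder (Fin n)} {α : SperPoint A} {u : Fin n → A} {γ : α.ValueGroup}

instance (S : ApproximateRootSystem m α u γ) : LinearOrder S.ι := S.linearOrder

instance (S : ApproximateRootSystem m α u γ) : WellFoundedLT S.ι := S.wellFounded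

/-- The root with index `i` is of complexity `k`: complexity `0` means that it is one of the
parameters; it is of complexity `k + 1` if it is not a parameter, all the roots appearing in its
expression are of complexity at most `k`, and at least one of them is of complexity `k`. -/
def HasComplexity (S : ApproximateRootSystem m α u γ) : ℕ → S.ι → Prop
  | 0, i => i ∈ Set.range S.idx
  | k + 1, i => i ∉ Set.range S.idx ∧
      (∀ j ∈ (S.Ex i).vars, ∃ l : Fin (k + 1), S.HasComplexity l j) ∧
      ∃ j ∈ (S.Ex i).vars, S.HasComplexity k j
termination_by k => k

/-- The polynomial `p` in `u_1, …, u_n` is the expression `Ex(Q)` of a root `Q` of complexity `1`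
of the system; the root itself is `Q = p(u)`. -/
def IsComplexityOneRoot (S : ApproximateRootSystem m α u γ) (p : MvPolynomial (Fin n) ℝ) : Prop :=
  ∃ i : S.ι, S.HasComplexity 1 i ∧ S.Ex i = rename S.idx p

end ApproximateRootSystem

/-- For a binomial `Q = u^η - λ u^θ` with initial monomial `u^η` this is
`Q' = Q / u^θ = u^η / u^θ - λ`, as an element of the field `A(α)`: here `θ` is the largest
exponent of `p` (for the order `m`) after the initial one has been removed. -/
def reducedRoot {n : ℕ} (m : MonomialOrder (Fin n)) (α : SperPoint A) (u : Fin n → A)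
    (p : MvPolynomial (Fin n) ℝ) : α.K :=
  α.eval (aeval u p) /
    α.eval (genMonomial u (m.degree (m.subLTerm p)))

/-- `(α, β)`-comparability of two approximate roots with expressions `p`, `q`. (Recall that the
order on values is reversed in multiplicative notation.) -/
def Comparable {n : ℕ} (m : MonomialOrder (Fin n)) (α β : SperPoint A) (u : Fin n → A)
    (p q : MvPolynomial (Fin n) ℝ) : Prop :=
  (α.val (reducedRoot m α u q) < α.val (reducedRoot m α u p) ∧
    β.val (reducedRoot m β u q) < β.val (reducedRoot m β u p)) ∨
  (α.val (reducedRoot m α u p) < α.val (reducedRoot m α u q) ∧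
    β.val (reducedRoot m β u p) < β.val (reducedRoot m β u q)) ∨
  (α.val (reducedRoot m α u p) = α.val (reducedRoot m α u q) ∧
    β.val (reducedRoot m β u p) = β.val (reducedRoot m β u q) ∧
    ∃ c : ℝ, α.InitialRatioEq (reducedRoot m α u p) (reducedRoot m α u q) c ∧
      β.InitialRatioEq (reducedRoot m β u p) (reducedRoot m β u q) c)

end ApproximateRoots

end

/-! The residue field being `ℝ`, every graded piece of `ν_α` has dimension at most one over `ℝ`.
Hence a root of complexity one is a binomial (`exists_isBinomialRoot`), and the Laurent monomial
`u^w`, `w = η - θ`, equals `λ + Q'` with `λ ≠ 0` real and `Q'` of positive value.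

The three vectors `w_i` are dependent: otherwise a nonzero power of a parameter would be a product
of Laurent monomials of value zero (`det_exponents_eq_zero`). Any two are independent, because
initial monomials are minimal among nonstandard ones (`IsBinomialRoot.independent`). So some
relation `∑ a_i w_i = 0` has all `a_i ≠ 0`. It yields `∏ (λ_i + Q_i')^{a_i} = 1` in both `A(α)` and
`A(β)`, and to first order `∑ (a_i / λ_i) Q_i'` vanishes (`exists_orthogonal_coeffs`).

Let `r`, `r'` be the vectors of leading coefficients of the `Q_i'` at `α` and `β`, measured against
a dominant `Q_i'`. Both are orthogonal to the same vector `b = (a_i / λ_i)`, which has no zero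
coordinate. Comparability of `i` and `k` says `r_i r'_k = r_k r'_i` (`comparable_iff`), that is, a
coordinate of `r × r'` vanishes. As `r × r'` is a multiple of `b`, its coordinates vanish all
together or not at all (`minors_all_or_none`). -/

/-! ### Valuations whose residue field is `ℝ` -/

section RealResidue

variable {K Γ : Type*} [Field K] [LinearOrderedCommGroupWithZero Γ]

/-- The valuation `v` is trivial on the real numbers, and its residue field is `ℝ`. -/
structure HasRealResidueField (v : Valuation K Γ) (j : ℝ →+* K) : Prop where
  map_real : ∀ c : ℝ, c ≠ 0 → v (j c) = 1
  exists_real : ∀ x : K, v x ≤ 1 → ∃ c : ℝ, v (x - j c) < 1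

namespace HasRealResidueField

variable {v : Valuation K Γ} {j : ℝ →+* K}

theorem map_real_le (h : HasRealResidueField v j) (c : ℝ) : v (j c) ≤ 1 := by
  by_cases hc : c = 0
  · simp [hc]
  · exact (h.map_real c hc).le

theorem eq_zero_of_lt_one (h : HasRealResidueField v j) {c : ℝ} (hc : v (j c) < 1) : c = 0 := by
  by_contra h0
  exact hc.ne (h.map_real c h0)

theorem eq_zero_of_mul_lt (h : HasRealResidueField v j) {c : ℝ} {s : K}
    (hc : v (j c * s) < v s) : c = 0 := by
  by_contra h0
  rw [map_mul, h.map_real c h0, one_mul] at hc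
  exact lt_irrefl _ hc

theorem exists_real_mul (h : HasRealResidueField v j) {x s : K} (hs : v s ≠ 0) (hx : v x ≤ v s) :
    ∃ c : ℝ, v (x - j c * s) < v s := by
  have hs0 : s ≠ 0 := fun h0 => hs (by simp [h0])
  obtain ⟨c, hc⟩ := h.exists_real (x / s) (by
    rw [map_div₀]; exact div_le_one_of_le₀ hx zero_le)
  refine ⟨c, ?_⟩
  have : x - j c * s = (x / s - j c) * s := by field_simp
  rw [this, map_mul]
  calc v (x / s - j c) * v s < 1 * v s := by
        exact mul_lt_mul_of_pos_right hc (zero_lt_iff.2 hs)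
    _ = v s := one_mul _

/-- The reference element `s` is a `z i` of smallest additive value; its own coefficient cannot be
zero. -/
theorem exists_leading_coeffs (h : HasRealResidueField v j) {ι : Type*} [Fintype ι] [Nonempty ι]
    (z : ι → K) (hz : ∀ i, z i ≠ 0) :
    ∃ (s : K) (r : ι → ℝ), (∃ i, s = z i) ∧ (∃ i, r i ≠ 0) ∧ (∀ i, v (z i) ≤ v s) ∧
      ∀ i, v (z i - j (r i) * s) < v s := by
  obtain ⟨i₀, hi₀⟩ := Finite.exists_max fun i => v (z i)
  have hs : v (z i₀) ≠ 0 := (Valuation.ne_zero_iff v).2 (hz i₀)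
  choose r hr using fun i => h.exists_real_mul hs (hi₀ i)
  refine ⟨z i₀, r, ⟨i₀, rfl⟩, ⟨i₀, fun h0 => ?_⟩, hi₀, hr⟩
  have := hr i₀
  simp [h0] at this

theorem map_eq_of_coeff_ne_zero (h : HasRealResidueField v j) {x s : K} {a : ℝ}
    (hx : v (x - j a * s) < v s) (ha : a ≠ 0) : v x = v s := by
  have h1 : v (j a * s) = v s := by rw [map_mul, h.map_real a ha, one_mul]
  have := Valuation.map_add_eq_of_lt_right v (x := x - j a * s) (y := j a * s) (by rwa [h1])
  rwa [sub_add_cancel, h1] at this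

theorem map_lt_iff (h : HasRealResidueField v j) {x s : K} {a : ℝ}
    (hx : v (x - j a * s) < v s) : v x < v s ↔ a = 0 := by
  constructor
  · intro hlt
    by_contra ha
    exact hlt.ne (h.map_eq_of_coeff_ne_zero hx ha)
  · rintro rfl
    simpa using hx

/-- An element with zero coefficient is negligible against `s`, one with nonzero coefficient has the
size of `s`. If both coefficients vanished, nothing could be concluded, whence `hab`. -/
theorem map_lt_map_iff (h : HasRealResidueField v j) {x y s : K} {a b : ℝ}
    (hx : v (x - j a * s) < v s) (hy : v (y - j b * s) < v s) (hab : a ≠ 0 ∨ b ≠ 0) :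
    v x < v y ↔ a = 0 := by
  by_cases ha : a = 0
  · have hb : b ≠ 0 := by tauto
    rw [h.map_eq_of_coeff_ne_zero hy hb, h.map_lt_iff hx]
  · have : v y ≤ v s := by
      by_cases hb : b = 0
      · exact ((h.map_lt_iff hy).2 hb).le
      · exact (h.map_eq_of_coeff_ne_zero hy hb).le
    simp only [ha, iff_false, not_lt]
    rwa [h.map_eq_of_coeff_ne_zero hx ha]

theorem initial_ratio_iff (h : HasRealResidueField v j) {x y s : K} {a b : ℝ} (c : ℝ)
    (hx : v (x - j a * s) < v s) (hy : v (y - j b * s) < v s) (hab : a ≠ 0 ∨ b ≠ 0) :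
    (v x = v y ∧ v (x - j c * y) < v y) ↔ a ≠ 0 ∧ b ≠ 0 ∧ a = c * b := by
  have hxy := h.map_lt_map_iff hx hy hab
  have hyx := h.map_lt_map_iff hy hx hab.symm
  have key : v ((x - j c * y) - j (a - c * b) * s) < v s := by
    have e : (x - j c * y) - j (a - c * b) * s = (x - j a * s) - j c * (y - j b * s) := by
      simp only [map_sub, map_mul]; ring
    rw [e]
    refine Valuation.map_sub_lt v hx ?_
    rw [map_mul]
    exact (mul_le_of_le_one_left' (h.map_real_le c)).trans_lt hy
  constructor
  · rintro ⟨h1, h2⟩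
    have ha : a ≠ 0 := fun h0 => (hxy.2 h0).ne h1
    have hb : b ≠ 0 := fun h0 => (hyx.2 h0).ne' h1
    rw [h.map_eq_of_coeff_ne_zero hy hb, h.map_lt_iff key, sub_eq_zero] at h2
    exact ⟨ha, hb, h2⟩
  · rintro ⟨ha, hb, hc⟩
    rw [h.map_eq_of_coeff_ne_zero hx ha, h.map_eq_of_coeff_ne_zero hy hb, h.map_lt_iff key,
      sub_eq_zero]
    exact ⟨rfl, hc⟩

theorem sum_coeff_eq_zero (h : HasRealResidueField v j) {ι : Type*} [Fintype ι]
    {z : ι → K} {s : K} {r b : ι → ℝ} (hr : ∀ i, v (z i - j (r i) * s) < v s)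
    (hb : v (∑ i, j (b i) * z i) < v s) : ∑ i, b i * r i = 0 := by
  apply h.eq_zero_of_mul_lt (s := s)
  have e : j (∑ i, b i * r i) * s
      = (∑ i, j (b i) * z i) - ∑ i, j (b i) * (z i - j (r i) * s) := by
    rw [← Finset.sum_sub_distrib, map_sum, Finset.sum_mul]
    refine Finset.sum_congr rfl fun i _ => ?_
    rw [map_mul]; ring
  rw [e]
  refine Valuation.map_sub_lt v hb ?_
  refine Valuation.map_sum_lt v (fun h0 => ?_) fun i _ => ?_
  · rw [h0] at hb; exact not_lt_zero hb
  · rw [map_mul]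
    exact (mul_le_of_le_one_left' (h.map_real_le _)).trans_lt (hr i)

end HasRealResidueField

/-! ### First-order expansions of products and powers -/

/-- `x = 1 + t` up to second order, for elements `t` of size at most `M`. -/
def IsFirstOrder (v : Valuation K Γ) (M : Γ) (x t : K) : Prop :=
  v t ≤ M ∧ v (x - 1 - t) ≤ M ^ 2

namespace IsFirstOrder

variable {v : Valuation K Γ} {M : Γ} {x y t t' : K}

theorem one : IsFirstOrder v M 1 0 := by
  simp [IsFirstOrder]

theorem one_add (ht : v t ≤ M) : IsFirstOrder v M (1 + t) t := by
  simp [IsFirstOrder, ht]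

theorem mul (hM : M < 1) (hx : IsFirstOrder v M x t) (hy : IsFirstOrder v M y t') :
    IsFirstOrder v M (x * y) (t + t') := by
  obtain ⟨h1, h2⟩ := hx
  obtain ⟨h3, h4⟩ := hy
  refine ⟨Valuation.map_add_le v h1 h3, ?_⟩
  have e : x * y - 1 - (t + t') =
      (x - 1 - t) * (y - 1 - t') + (x - 1 - t) * (1 + t') + (1 + t) * (y - 1 - t') + t * t' := by
    ring
  have h5 : v (1 + t) ≤ 1 := Valuation.map_add_le v (by simp) (h1.trans hM.le)
  have h6 : v (1 + t') ≤ 1 := Valuation.map_add_le v (by simp) (h3.trans hM.le)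
  have hM2 : M ^ 2 ≤ 1 := pow_le_one' hM.le 2
  rw [e]
  refine Valuation.map_add_le v (Valuation.map_add_le v (Valuation.map_add_le v ?_ ?_) ?_) ?_
  · rw [map_mul]; simpa using mul_le_mul' h2 (h4.trans hM2)
  · rw [map_mul]; simpa using mul_le_mul' h2 h6
  · rw [map_mul]; simpa using mul_le_mul' h5 h4
  · rw [map_mul, pow_two]; exact mul_le_mul' h1 h3

theorem inv (hM : M < 1) (hx : IsFirstOrder v M x t) : IsFirstOrder v M x⁻¹ (-t) := by
  obtain ⟨h1, h2⟩ := hx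
  have hMM : M ^ 2 ≤ M := by
    rw [pow_two]; exact mul_le_of_le_one_left' hM.le
  have hv : v x = 1 := by
    have h3 : v ((x - 1 - t) + t) < 1 :=
      (Valuation.map_add_le v (h2.trans hMM) h1).trans_lt hM
    have h4 := Valuation.map_add_eq_of_lt_right v (x := (x - 1 - t) + t) (y := 1) (by simpa using h3)
    rw [map_one] at h4
    rw [← h4]; congr 1; ring
  have hx0 : x ≠ 0 := fun h0 => by simp [h0] at hv
  refine ⟨by rwa [Valuation.map_neg], ?_⟩
  have e : x⁻¹ - 1 - -t = x⁻¹ * (t * t + t * (x - 1 - t) - (x - 1 - t)) := by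
    field_simp; ring
  rw [e, map_mul, map_inv₀, hv, inv_one, one_mul]
  refine Valuation.map_sub_le v (Valuation.map_add_le v ?_ ?_) h2
  · rw [map_mul, pow_two]; exact mul_le_mul' h1 h1
  · rw [map_mul]; simpa using mul_le_mul' (h1.trans hM.le) h2

theorem pow (hM : M < 1) (hx : IsFirstOrder v M x t) (n : ℕ) :
    IsFirstOrder v M (x ^ n) (n * t) := by
  induction n with
  | zero => simpa using one
  | succ n ih =>
    have := ih.mul hM hx
    rw [pow_succ]
    convert this using 1
    push_cast; ring

theorem zpow (hM : M < 1) (hx : IsFirstOrder v M x t) (n : ℤ) :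
    IsFirstOrder v M (x ^ n) (n * t) := by
  cases n with
  | ofNat n => simpa using hx.pow hM n
  | negSucc n =>
    have := (hx.pow hM (n + 1)).inv hM
    rw [zpow_negSucc]
    convert this using 1
    push_cast; ring

theorem prod (hM : M < 1) {ι : Type*} (s : Finset ι) {x t : ι → K}
    (hx : ∀ i ∈ s, IsFirstOrder v M (x i) (t i)) :
    IsFirstOrder v M (∏ i ∈ s, x i) (∑ i ∈ s, t i) := by
  classical
  induction s using Finset.induction_on with
  | empty => simpa using one
  | insert a s ha ih =>
    rw [Finset.prod_insert ha, Finset.sum_insert ha]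
    exact (hx a (by simp)).mul hM (ih fun i hi => hx i (by simp [hi]))

end IsFirstOrder

/-- A multiplicative relation between elements `λ_i + q_i`, where the `λ_i` are real and the `q_i`
infinitesimal, yields a linear relation between the leading coefficients of the `q_i`. -/
theorem HasRealResidueField.exists_orthogonal_coeffs {v : Valuation K Γ} {j : ℝ →+* K}
    (h : HasRealResidueField v j) {ι : Type*} [Fintype ι] [Nonempty ι]
    {l : ι → ℝ} (hl : ∀ i, l i ≠ 0) {q : ι → K} (hq : ∀ i, q i ≠ 0) (hq1 : ∀ i, v (q i) < 1)
    {a : ι → ℤ} (hrel : ∏ i, (j (l i) + q i) ^ a i = 1) :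
    ∃ (s : K) (r : ι → ℝ), (∃ i, r i ≠ 0) ∧ (∀ i, v (q i - j (r i) * s) < v s) ∧
      ∑ i, (a i / l i) * r i = 0 := by
  obtain ⟨s, r, ⟨i₀, rfl⟩, hr, hmax, hcoeff⟩ := h.exists_leading_coeffs q hq
  refine ⟨q i₀, r, hr, hcoeff, h.sum_coeff_eq_zero hcoeff ?_⟩
  set M := v (q i₀)
  have hM : M < 1 := hq1 i₀
  have hM0 : 0 < M := zero_lt_iff.2 ((Valuation.ne_zero_iff v).2 (hq i₀))
  have hMM : M ^ 2 < M := by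
    rw [pow_two]; simpa using mul_lt_mul_of_pos_right hM hM0
  have hj : ∀ i, j (l i) ≠ 0 := fun i => (map_ne_zero j).2 (hl i)
  have hfo := IsFirstOrder.prod hM Finset.univ (x := fun i => (1 + j (l i)⁻¹ * q i) ^ a i)
    (t := fun i => a i * (j (l i)⁻¹ * q i)) (v := v) fun i _ => by
      refine (IsFirstOrder.one_add ?_).zpow hM _
      rw [map_mul, h.map_real _ (inv_ne_zero (hl i)), one_mul]
      exact hmax i
  -- Dividing each factor by `l i` turns it into `1 +` infinitesimal; by `hrel` the product of the
  -- normalized factors is a real constant.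
  have hprod : ∏ i, (1 + j (l i)⁻¹ * q i) ^ a i = j (∏ i, (l i)⁻¹ ^ a i) := by
    have e : ∀ i, (1 + j (l i)⁻¹ * q i) ^ a i = j ((l i)⁻¹ ^ a i) * (j (l i) + q i) ^ a i := by
      intro i
      rw [map_zpow₀, ← mul_zpow, mul_add, ← map_mul, inv_mul_cancel₀ (hl i), map_one]
    rw [Finset.prod_congr rfl fun i _ => e i, Finset.prod_mul_distrib, hrel, mul_one, map_prod]
  have hsum : ∑ i, (a i : K) * (j (l i)⁻¹ * q i) = ∑ i, j (a i / l i) * q i := by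
    refine Finset.sum_congr rfl fun i _ => ?_
    rw [div_eq_mul_inv, map_mul, map_intCast]; ring
  rw [hprod, hsum] at hfo
  obtain ⟨h1, h2⟩ := hfo
  -- This real constant is infinitely close to `1`, hence equal to `1`; the linear term is then of
  -- size at most `M ^ 2 < M`.
  have hone : (∏ i, (l i)⁻¹ ^ a i) - 1 = 0 := by
    apply h.eq_zero_of_lt_one
    have := Valuation.map_add_le v (h2.trans hMM.le) h1
    rw [sub_add_cancel] at this
    simpa using this.trans_lt hM
  rw [sub_eq_zero.1 hone, map_one, sub_self, zero_sub, Valuation.map_neg] at h2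
  exact h2.trans_lt hMM

/-! ### Linear algebra of the coefficient vectors -/

/-- The three alternatives mirror those of comparability; together they say that `(a : b)` and `(a'
: b')` are the same point of the projective line. -/
theorem ratio_eq_iff {a b a' b' : ℝ} (h : a ≠ 0 ∨ b ≠ 0) (h' : a' ≠ 0 ∨ b' ≠ 0) :
    (b = 0 ∧ b' = 0 ∨ a = 0 ∧ a' = 0 ∨
      ∃ c : ℝ, (a ≠ 0 ∧ b ≠ 0 ∧ a = c * b) ∧ (a' ≠ 0 ∧ b' ≠ 0 ∧ a' = c * b')) ↔
    a * b' = b * a' := by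
  constructor
  · rintro (⟨rfl, rfl⟩ | ⟨rfl, rfl⟩ | ⟨c, ⟨_, _, rfl⟩, _, _, rfl⟩)
    · simp
    · simp
    · ring
  · intro e
    by_cases hb : b = 0
    · subst hb
      simp_all
    by_cases ha : a = 0
    · subst ha
      simp_all
    have hb' : b' ≠ 0 := by
      rintro rfl
      simp_all
    have ha' : a' ≠ 0 := by
      rintro rfl
      simp_all
    refine Or.inr (Or.inr ⟨a / b, ⟨ha, hb, by field_simp⟩, ha', hb', ?_⟩)
    field_simp
    linarith

/-- If two coordinates of `r` vanished, the relation would kill the third as well. -/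
theorem coeff_ne_zero_or {b r : Fin 3 → ℝ} (hb : ∀ i, b i ≠ 0) (hr : ∃ i, r i ≠ 0)
    (h : ∑ i, b i * r i = 0) {i k : Fin 3} (hik : i ≠ k) : r i ≠ 0 ∨ r k ≠ 0 := by
  by_contra! hc
  obtain ⟨h1, h2⟩ := hc
  obtain ⟨l, hl⟩ := hr
  have hli : l ≠ i := by rintro rfl; exact hl h1
  have hlk : l ≠ k := by rintro rfl; exact hl h2
  have hother : ∀ t, t ≠ l → r t = 0 := by
    intro t ht
    have : t = i ∨ t = k := by omega
    rcases this with rfl | rfl <;> assumption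
  rw [Finset.sum_eq_single l (fun t _ ht => by rw [hother t ht, mul_zero]) (by simp)] at h
  exact (mul_ne_zero (hb l) hl) h

/-- For two vectors orthogonal to a vector without zero coordinates, either all `2 × 2` minors
vanish or none does. -/
theorem minors_all_or_none {b r r' : Fin 3 → ℝ} (hb : ∀ i, b i ≠ 0)
    (h : ∑ i, b i * r i = 0) (h' : ∑ i, b i * r' i = 0) :
    (∀ i k, i ≠ k → r i * r' k = r k * r' i) ∨ (∀ i k, i ≠ k → r i * r' k ≠ r k * r' i) := by
  rw [Fin.sum_univ_three] at h h'
  -- `e1` and `e2` express that `r × r'` is parallel to `b`.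
  have e1 : b 0 * (r 0 * r' 1 - r 1 * r' 0) = b 2 * (r 1 * r' 2 - r 2 * r' 1) := by
    linear_combination r' 1 * h - r 1 * h'
  have e2 : b 1 * (r 0 * r' 1 - r 1 * r' 0) = b 2 * (r 2 * r' 0 - r 0 * r' 2) := by
    linear_combination -r' 0 * h + r 0 * h'
  by_cases hD : r 0 * r' 1 - r 1 * r' 0 = 0
  · left
    rw [hD, mul_zero] at e1 e2
    have f1 := (mul_eq_zero.1 e1.symm).resolve_left (hb 2)
    have f2 := (mul_eq_zero.1 e2.symm).resolve_left (hb 2)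
    intro i k
    fin_cases i <;> fin_cases k <;> simp <;> linarith
  · right
    have f1 := (mul_ne_zero_iff.1 (e1 ▸ mul_ne_zero (hb 0) hD)).2
    have f2 := (mul_ne_zero_iff.1 (e2 ▸ mul_ne_zero (hb 1) hD)).2
    intro i k
    fin_cases i <;> fin_cases k <;> simp <;> intro e <;>
      first
      | exact hD (by linarith)
      | exact f1 (by linarith)
      | exact f2 (by linarith)

end RealResidue

/-! ### The valuation of a point of the real spectrum -/

namespace SperPoint

variable {A : Type*} [CommRing A] (α : SperPoint A)

theorem v_le_one (f : A) : α.v f ≤ 1 := by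
  refine (ValuationSubring.valuation_le_one_iff _ _).2 ?_
  by_cases h : 0 ≤ α.eval f
  · exact ⟨f, (abs_of_nonneg h).le⟩
  · exact ⟨-f, by rw [abs_of_neg (not_le.1 h), map_neg]⟩

theorem v_eq_zero_iff {f : A} : α.v f = 0 ↔ α.eval f = 0 :=
  map_eq_zero α.val

theorem v_mul (f g : A) : α.v (f * g) = α.v f * α.v g := by
  simp [v]

/-- If `f` vanishes at one of the two points, then `f` or `-f` satisfies the sign conditions of a
generator, whatever its sign at the other point. -/
theorem eval_ne_zero_of_notMem_separatingIdeal {α β : SperPoint A} {f : A}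
    (hf : f ∉ separatingIdeal α β) : α.eval f ≠ 0 ∧ β.eval f ≠ 0 := by
  have h1 : ¬ (0 ≤ α.eval f ∧ β.eval f ≤ 0) := fun h => hf (Ideal.subset_span h)
  have h2 : ¬ (0 ≤ α.eval (-f) ∧ β.eval (-f) ≤ 0) := fun h =>
    hf ((Ideal.neg_mem_iff _).1 (Ideal.subset_span h))
  rw [map_neg, map_neg, neg_nonneg, neg_nonpos] at h2
  constructor
  · intro h
    rcases le_total (β.eval f) 0 with h3 | h3
    · exact h1 ⟨h.ge, h3⟩
    · exact h2 ⟨h.le, h3⟩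
  · intro h
    rcases le_total (α.eval f) 0 with h3 | h3
    · exact h2 ⟨h3, h.ge⟩
    · exact h1 ⟨h3, h.le⟩

variable [Algebra ℝ A]

/-- The embedding of the real numbers in `A(α)`. -/
def real : ℝ →+* α.K := α.eval.comp (algebraMap ℝ A)

theorem real_mono : Monotone α.real := by
  intro a b hab
  have : α.real b - α.real a = α.real (Real.sqrt (b - a)) ^ 2 := by
    rw [← map_sub, ← map_pow, Real.sq_sqrt (sub_nonneg.2 hab)]
  rw [← sub_nonneg, this]
  exact sq_nonneg _

theorem real_strictMono : StrictMono α.real :=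
  α.real_mono.strictMono_of_injective α.real.injective

/-- A bound from `A` differs from a real number by an element of the maximal ideal, and such an
element is at most `1`: otherwise its inverse would lie in the valuation ring. -/
theorem exists_abs_le_real [IsLocalRing A]
    (hres : Function.Bijective (algebraMap ℝ (IsLocalRing.ResidueField A)))
    (hα : α.IsCentered) {x : α.K} (hx : α.val x ≤ 1) : ∃ r : ℝ, 0 < r ∧ |x| ≤ α.real r := by
  obtain ⟨a, ha⟩ := (ValuationSubring.valuation_le_one_iff _ _).1 hx
  obtain ⟨r, hr⟩ := hres.2 (IsLocalRing.residue A a)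
  have hm : a - algebraMap ℝ A r ∈ IsLocalRing.maximalIdeal A := by
    rw [← IsLocalRing.residue_eq_zero_iff, map_sub, ← hr, sub_eq_zero]
    rfl
  have hv := (hα _).2 hm
  have hlt : α.eval (a - algebraMap ℝ A r) ≤ 1 := by
    by_contra! hc
    have hpos : 0 < α.eval (a - algebraMap ℝ A r) := one_pos.trans hc
    have : α.val (α.eval (a - algebraMap ℝ A r))⁻¹ ≤ 1 := by
      refine (ValuationSubring.valuation_le_one_iff _ _).2 ⟨1, ?_⟩
      rw [map_one, abs_of_pos (inv_pos.2 hpos)]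
      exact inv_le_one_of_one_le₀ hc.le
    rw [map_inv₀] at this
    have h0 : 0 < α.val (α.eval (a - algebraMap ℝ A r)) :=
      zero_lt_iff.2 ((Valuation.ne_zero_iff _).2 hpos.ne')
    exact absurd ((inv_le_one₀ h0).1 this) (not_le.2 hv)
  refine ⟨max (r + 1) 1, by positivity, ha.trans (le_trans ?_ (α.real_mono (le_max_left _ _)))⟩
  rw [map_sub, sub_le_iff_le_add] at hlt
  rw [map_add, map_one, add_comm]
  exact hlt

theorem hasRealResidueField [IsLocalRing A]
    (hres : Function.Bijective (algebraMap ℝ (IsLocalRing.ResidueField A)))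
    (hα : α.IsCentered) : HasRealResidueField α.val α.real where
  map_real c hc := by
    refine le_antisymm (α.v_le_one _) ?_
    have h1 : α.val (α.real c⁻¹) ≤ 1 := α.v_le_one _
    have h2 : α.val (α.real c) * α.val (α.real c⁻¹) = 1 := by
      rw [← map_mul, ← map_mul, mul_inv_cancel₀ hc, map_one, map_one]
    calc (1 : α.ValueGroup) = α.val (α.real c) * α.val (α.real c⁻¹) := h2.symm
      _ ≤ α.val (α.real c) := mul_le_of_le_one_right' h1
  exists_real x hx := by
    obtain ⟨R, hR0, hR⟩ := α.exists_abs_le_real hres hα hx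
    obtain ⟨hR1, hR2⟩ := abs_le.1 hR
    have hne : {c : ℝ | α.real c ≤ x}.Nonempty := ⟨-R, by simpa using hR1⟩
    have hbdd : BddAbove {c : ℝ | α.real c ≤ x} :=
      ⟨R, fun c hc => α.real_strictMono.le_iff_le.1 (le_trans hc hR2)⟩
    -- `s` is the standard part of `x`: the difference `x - s` is smaller than every positive real.
    set s := sSup {c : ℝ | α.real c ≤ x}
    refine ⟨s, ?_⟩
    have hsmall : ∀ e : ℝ, 0 < e → |x - α.real s| ≤ α.real e := by
      intro e he
      rw [abs_le]
      constructor
      · obtain ⟨c, hc, hlt⟩ := exists_lt_of_lt_csSup hne (sub_lt_self s he)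
        have := (α.real_mono hlt.le).trans hc
        rw [map_sub] at this
        linarith
      · have : ¬ α.real (s + e) ≤ x := fun hc =>
          absurd (le_csSup hbdd hc) (not_le.2 (lt_add_of_pos_right s he))
        rw [map_add] at this
        linarith
    by_contra! hc
    have hd : x - α.real s ≠ 0 := by
      intro h0
      rw [h0, map_zero] at hc
      exact absurd hc (not_le.2 zero_lt_one)
    obtain ⟨T, hT0, hT⟩ := α.exists_abs_le_real hres hα (x := (x - α.real s)⁻¹) (by
      rw [map_inv₀]; exact inv_le_one_of_one_le₀ hc)
    -- With `T` bounding the inverse of `x - s`, this choice bounds `1` by `T * (T⁻¹ / 2) = 1 / 2`.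
    have h1 := hsmall (T⁻¹ / 2) (by positivity)
    have h2 : (1 : α.K) ≤ α.real (1 / 2) := by
      calc (1 : α.K) = |(x - α.real s)⁻¹| * |x - α.real s| := by
            rw [← abs_mul, inv_mul_cancel₀ hd, abs_one]
        _ ≤ α.real T * α.real (T⁻¹ / 2) :=
            mul_le_mul hT h1 (abs_nonneg _) ((abs_nonneg _).trans hT)
        _ = α.real (1 / 2) := by
            rw [← map_mul]; congr 1; field_simp
    rw [← map_one α.real, α.real_strictMono.le_iff_le] at h2
    norm_num at h2

end SperPoint

/-! ### Generalized monomials -/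

theorem genMonomial_add {A ι : Type*} [CommRing A] (Q : ι → A) (δ ε : ι →₀ ℕ) :
    genMonomial Q (δ + ε) = genMonomial Q δ * genMonomial Q ε := by
  classical
  exact Finsupp.prod_add_index' (fun _ => pow_zero _) fun _ _ _ => pow_add _ _ _

theorem genMonomial_mapDomain {A ι κ : Type*} [CommRing A] (Q : ι → A) {f : κ → ι}
    (hf : Function.Injective f) (δ : κ →₀ ℕ) :
    genMonomial Q (δ.mapDomain f) = genMonomial (Q ∘ f) δ :=
  Finsupp.prod_mapDomain_index_inj hf

theorem genMonomial_eq_prod {A ι : Type*} [CommRing A] [Fintype ι] (Q : ι → A) (δ : ι →₀ ℕ) :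
    genMonomial Q δ = ∏ k, Q k ^ δ k :=
  Finsupp.prod_fintype _ _ fun _ => pow_zero _

theorem aeval_monomial_genMonomial {A ι : Type*} [CommRing A] [Algebra ℝ A] (Q : ι → A)
    (δ : ι →₀ ℕ) (c : ℝ) :
    aeval Q (monomial δ c) = algebraMap ℝ A c * genMonomial Q δ :=
  aeval_monomial _ _ _

/-! ### Roots of complexity one as binomials -/

section Binomials

variable {n : ℕ} (m : MonomialOrder (Fin n))

theorem degree_binomial {η θ : Fin n →₀ ℕ} {c : ℝ} (h : m.toSyn θ < m.toSyn η) :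
    m.degree (monomial η (1 : ℝ) - monomial θ c) = η := by
  classical
  have h1 : m.degree (monomial η (1 : ℝ)) = η := by
    rw [m.degree_monomial, if_neg one_ne_zero]
  rw [m.degree_sub_of_lt, h1]
  rw [h1]
  exact (m.degree_monomial_le c).trans_lt h

theorem degree_subLTerm_binomial {η θ : Fin n →₀ ℕ} {c : ℝ} (hc : c ≠ 0)
    (h : m.toSyn θ < m.toSyn η) :
    m.degree (m.subLTerm (monomial η (1 : ℝ) - monomial θ c)) = θ := by
  classical
  have hne : θ ≠ η := fun e => (lt_irrefl _ (e ▸ h))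
  have hl : m.leadingCoeff (monomial η (1 : ℝ) - monomial θ c) = 1 := by
    rw [MonomialOrder.leadingCoeff, degree_binomial m h]
    simp [coeff_monomial, hne]
  rw [MonomialOrder.subLTerm, degree_binomial m h, hl, sub_sub_cancel_left, m.degree_neg,
    m.degree_monomial, if_neg hc]

variable {A : Type*} [CommRing A] [Algebra ℝ A]

/-- `p = X^η - l X^θ` is the expression of an approximate root of complexity one:
the value jumps, and no monomial properly dividing `u^η` has the value of a smaller monomial. -/
structure IsBinomialRoot (α : SperPoint A) (u : Fin n → A) (p : MvPolynomial (Fin n) ℝ)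
    (η θ : Fin n →₀ ℕ) (l : ℝ) : Prop where
  eq : p = monomial η 1 - monomial θ l
  ne_zero : l ≠ 0
  lt : m.toSyn θ < m.toSyn η
  v_eq : α.v (genMonomial u θ) = α.v (genMonomial u η)
  jump : α.v (aeval u p) < α.v (genMonomial u η)
  minimal : ∀ δ ≤ η, δ ≠ η → ∀ ε, m.toSyn ε < m.toSyn δ →
    α.v (genMonomial u ε) ≠ α.v (genMonomial u δ)

/-- Graded pieces being at most real lines, a single smaller monomial of the same finite value
already spans the initial form. -/
theorem ApproximateRootSystem.not_isStandard {m : MonomialOrder (Fin n)} {α : SperPoint A}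
    {u : Fin n → A} {γ : α.ValueGroup} (S : ApproximateRootSystem m α u γ)
    (hα : HasRealResidueField α.val α.real) (i : S.ι) {δ ε : S.ι →₀ ℕ}
    (hε : ∀ j ∈ ε.support, j < i) (hlt : S.lt ε δ)
    (hv : α.v (genMonomial S.Q ε) = α.v (genMonomial S.Q δ))
    (h0 : α.v (genMonomial S.Q δ) ≠ 0) : ¬ IsStandard α S.lt S.Q i δ := by
  intro hst
  obtain ⟨c, hc⟩ := hα.exists_real_mul (x := α.eval (genMonomial S.Q δ))
    (s := α.eval (genMonomial S.Q ε)) (by rw [← SperPoint.v, hv]; exact h0) hv.ge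
  refine hst ⟨monomial ε c, fun ζ hζ => ?_, ?_⟩
  · have := support_monomial_subset hζ
    rw [Finset.mem_singleton] at this
    subst this
    exact ⟨hε, hlt, hv⟩
  · rw [aeval_monomial_genMonomial, ← hv, SperPoint.v, map_sub, map_mul]
    exact hc

theorem Finsupp.mapDomain_le_mapDomain {ι κ : Type*} (f : ι → κ) {δ η : ι →₀ ℕ} (h : δ ≤ η) :
    δ.mapDomain f ≤ η.mapDomain f := by
  classical
  obtain ⟨ζ, rfl⟩ := exists_add_of_le h
  rw [Finsupp.mapDomain_add]
  exact le_self_add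

/-- Of two monomials of equal finite value the larger is not standard, so the tail has at most one
term; it has one, because a lone monomial makes no jump of value. -/
theorem ApproximateRootSystem.IsComplexityOneRoot.exists_isBinomialRoot
    {m : MonomialOrder (Fin n)} {α : SperPoint A}
    {u : Fin n → A} {γ : α.ValueGroup} {S : ApproximateRootSystem m α u γ}
    (hα : HasRealResidueField α.val α.real) {p : MvPolynomial (Fin n) ℝ}
    (hp : S.IsComplexityOneRoot p) : ∃ η θ l, IsBinomialRoot m α u p η θ l := by
  classical
  obtain ⟨i, hi, hEx⟩ := hp
  have hi' : i ∉ Set.range S.idx := by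
    rw [ApproximateRootSystem.HasComplexity] at hi
    exact hi.1
  obtain ⟨lead, tail, hpt, -, htail, hst, hjump, hmin⟩ := S.admissible i hi'
  rw [hEx] at hpt hjump
  have hinj := S.idx_strictMono.injective
  have hQ : S.Q ∘ S.idx = u := funext S.Q_idx
  have hgen : ∀ δ, genMonomial S.Q (δ.mapDomain S.idx) = genMonomial u δ := fun δ => by
    rw [genMonomial_mapDomain _ hinj, hQ]
  have hlt : ∀ (δ : Fin n →₀ ℕ), ∀ k ∈ (δ.mapDomain S.idx).support, k < i := by
    intro δ k hk
    obtain ⟨t, -, rfl⟩ := Finset.mem_image.1 (Finsupp.mapDomain_support hk)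
    exact S.idx_lt i hi' t
  have hirr := S.isExponentOrder.irrefl
  have hlead_tail : coeff lead tail = 0 := by
    by_contra h
    exact hirr _ (htail lead (mem_support_iff.2 h)).2.1
  -- The tail cannot cancel the initial monomial, so `lead` occurs in the renamed `p` and is an
  -- exponent in the parameters; the same goes for the tail exponents below.
  obtain ⟨η, rfl, -⟩ := coeff_rename_ne_zero S.idx p lead (by
    rw [hpt, coeff_sub, hlead_tail, coeff_monomial, if_pos rfl]; norm_num)
  have hexp : ∀ ε ∈ tail.support, ∃ θ : Fin n →₀ ℕ, θ.mapDomain S.idx = ε := by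
    intro ε hε
    have hne : η.mapDomain S.idx ≠ ε := fun e => hirr ε (by
      have := (htail ε hε).2.1; rwa [e] at this)
    obtain ⟨θ, hθ, -⟩ := coeff_rename_ne_zero S.idx p ε (by
      rw [hpt, coeff_sub, coeff_monomial, if_neg hne, zero_sub]
      exact neg_ne_zero.2 (mem_support_iff.1 hε))
    exact ⟨θ, hθ⟩
  rw [aeval_rename, hQ, hgen] at hjump
  have hη0 : α.v (genMonomial u η) ≠ 0 := fun h => by
    rw [h] at hjump; exact not_lt_zero hjump
  have htail0 : tail ≠ 0 := by
    rintro rfl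
    have : p = monomial η 1 := rename_injective _ hinj (by rw [hpt, sub_zero, rename_monomial])
    rw [this, aeval_monomial_genMonomial, map_one, one_mul] at hjump
    exact lt_irrefl _ hjump
  obtain ⟨ε, hε⟩ := Finset.nonempty_iff_ne_empty.2 (support_eq_empty.not.2 htail0)
  obtain ⟨θ, rfl⟩ := hexp ε hε
  have hnst : ∀ ε₁ ∈ tail.support, ∀ ε₂ ∈ tail.support, ¬ S.lt ε₁ ε₂ := by
    intro ε₁ h₁ ε₂ h₂ h₁₂
    refine S.not_isStandard hα i (htail ε₁ h₁).1 h₁₂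
      ((htail ε₁ h₁).2.2.trans (htail ε₂ h₂).2.2.symm) ?_ (hst ε₂ h₂)
    rw [(htail ε₂ h₂).2.2, hgen]
    exact hη0
  have huniq : ∀ ε ∈ tail.support, ε = θ.mapDomain S.idx := by
    intro ε' hε'
    by_contra hne
    rcases S.isExponentOrder.total _ _ hne with h | h
    · exact hnst _ hε' _ hε h
    · exact hnst _ hε _ hε' h
  have htail_eq : tail = monomial (θ.mapDomain S.idx) (coeff (θ.mapDomain S.idx) tail) := by
    ext ζ
    rw [coeff_monomial]
    split_ifs with h
    · rw [h]
    · by_contra h0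
      exact h (huniq ζ (mem_support_iff.2 h0)).symm
  refine ⟨η, θ, coeff (θ.mapDomain S.idx) tail, ?_, mem_support_iff.1 hε,
    (S.lt_idx _ _).1 (htail _ hε).2.1, ?_, hjump, ?_⟩
  · apply rename_injective _ hinj
    rw [hpt, map_sub, rename_monomial, rename_monomial, ← htail_eq]
  · have := (htail _ hε).2.2
    rwa [hgen, hgen] at this
  · intro δ hδ hne ε hεδ hv
    refine S.not_isStandard hα i (hlt ε) ((S.lt_idx _ _).2 hεδ) (by rw [hgen, hgen, hv]) ?_
      (hmin _ (Finsupp.mapDomain_le_mapDomain _ hδ)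
        ((Finsupp.mapDomain_injective hinj).ne hne))
    obtain ⟨ζ, rfl⟩ := exists_add_of_le hδ
    rw [genMonomial_add, SperPoint.v_mul] at hη0
    rw [hgen]
    exact left_ne_zero_of_mul hη0

namespace IsBinomialRoot

variable {m} {α : SperPoint A} {u : Fin n → A} {p p' : MvPolynomial (Fin n) ℝ}
  {η θ η' θ' : Fin n →₀ ℕ} {l l' : ℝ}

theorem degree_eq (h : IsBinomialRoot m α u p η θ l) : m.degree p = η := by
  rw [h.eq, degree_binomial m h.lt]

theorem degree_subLTerm_eq (h : IsBinomialRoot m α u p η θ l) :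
    m.degree (m.subLTerm p) = θ := by
  rw [h.eq, degree_subLTerm_binomial m h.ne_zero h.lt]

theorem exponent_ne (h : IsBinomialRoot m α u p η θ l) : θ ≠ η := fun e => by
  have := h.lt
  rw [e] at this
  exact lt_irrefl _ this

theorem coeff_eq (h : IsBinomialRoot m α u p η θ l) : coeff θ p = -l := by
  classical
  rw [h.eq, coeff_sub, coeff_monomial, coeff_monomial, if_neg h.exponent_ne.symm, if_pos rfl,
    zero_sub]

/-- The data `η`, `θ`, `l` are read off `p` and the monomial order alone, so they do not depend on
the point. -/
theorem unique {β : SperPoint A} (h : IsBinomialRoot m α u p η θ l)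
    (h' : IsBinomialRoot m β u p η' θ' l') : η' = η ∧ θ' = θ ∧ l' = l := by
  obtain rfl : η' = η := h'.degree_eq.symm.trans h.degree_eq
  obtain rfl : θ' = θ := h'.degree_subLTerm_eq.symm.trans h.degree_subLTerm_eq
  exact ⟨rfl, rfl, neg_injective (h'.coeff_eq.symm.trans h.coeff_eq)⟩

theorem v_lead_ne_zero (h : IsBinomialRoot m α u p η θ l) : α.v (genMonomial u η) ≠ 0 :=
  fun h0 => by
    have := h.jump
    rw [h0] at this
    exact not_lt_zero this

theorem v_tail_ne_zero (h : IsBinomialRoot m α u p η θ l) : α.v (genMonomial u θ) ≠ 0 :=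
  h.v_eq ▸ h.v_lead_ne_zero

theorem eval_aeval (h : IsBinomialRoot m α u p η θ l) :
    α.eval (aeval u p) = α.eval (genMonomial u η) - α.real l * α.eval (genMonomial u θ) := by
  rw [h.eq, map_sub, aeval_monomial_genMonomial, aeval_monomial_genMonomial, map_one, one_mul,
    map_sub, map_mul]
  rfl

theorem lead_ne_zero (h : IsBinomialRoot m α u p η θ l) : η ≠ 0 := by
  rintro rfl
  have := h.lt
  rw [map_zero] at this
  exact not_lt_bot this

/-- A parameter common to both monomials could be cancelled, leaving a proper divisor of `u^η` with
the value of a smaller monomial. -/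
theorem disjoint (h : IsBinomialRoot m α u p η θ l) (t : Fin n) : η t = 0 ∨ θ t = 0 := by
  by_contra! hc
  have h1 : η = (η - Finsupp.single t 1) + Finsupp.single t 1 :=
    (tsub_add_cancel_of_le (by simpa using Nat.one_le_iff_ne_zero.2 hc.1)).symm
  have h2 : θ = (θ - Finsupp.single t 1) + Finsupp.single t 1 :=
    (tsub_add_cancel_of_le (by simpa using Nat.one_le_iff_ne_zero.2 hc.2)).symm
  have hv := h.v_eq
  have hlt := h.lt
  have h0 := h.v_lead_ne_zero
  rw [h1, genMonomial_add, SperPoint.v_mul] at h0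
  rw [h1, h2, genMonomial_add, genMonomial_add, SperPoint.v_mul, SperPoint.v_mul] at hv
  rw [h1, h2, map_add, map_add] at hlt
  refine h.minimal _ tsub_le_self (fun e => ?_) _ (lt_of_add_lt_add_right hlt)
    (mul_right_cancel₀ (right_ne_zero_of_mul h0) hv)
  have := DFunLike.congr_fun e t
  simp at this
  omega

theorem eq_of_le (h : IsBinomialRoot m α u p η θ l) (h' : IsBinomialRoot m α u p' η' θ' l')
    (hle : η ≤ η') : η = η' := by
  by_contra hne
  exact h'.minimal η hle hne θ h.lt h.v_eq

/-- The difference of the two roots is a real multiple of `u^θ` of value greater than that of `u^θ`,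
so the multiple is zero. -/
theorem eq_of_exponents (hα : HasRealResidueField α.val α.real)
    (h : IsBinomialRoot m α u p η θ l) (h' : IsBinomialRoot m α u p' η θ l') : p = p' := by
  have e : α.real (l' - l) * α.eval (genMonomial u θ) =
      α.eval (aeval u p) - α.eval (aeval u p') := by
    rw [h.eval_aeval, h'.eval_aeval, map_sub]; ring
  have : l' - l = 0 := by
    apply hα.eq_zero_of_mul_lt (s := α.eval (genMonomial u θ))
    rw [e]
    have h3 := h.v_eq
    exact Valuation.map_sub_lt _ (h.jump.trans_eq h3.symm) (h'.jump.trans_eq h3.symm)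
  rw [h.eq, h'.eq, sub_eq_zero.1 this]

/-- As `η` and `θ` have disjoint supports, they are the positive and negative parts of `η - θ`.
Positively proportional vectors thus have proportional initial exponents, one of which divides the
other; minimality makes them equal. -/
theorem eq_of_pos_collinear (hα : HasRealResidueField α.val α.real)
    (h : IsBinomialRoot m α u p η θ l) (h' : IsBinomialRoot m α u p' η' θ' l') {b c : ℕ}
    (hb : 0 < b) (hc : 0 < c) (hbc : ∀ t, b * η t + c * θ' t = b * θ t + c * η' t) : p = p' := by
  have hη : ∀ t, b * η t = c * η' t := by
    intro t
    have e := hbc t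
    rcases h.disjoint t with h1 | h1 <;> rcases h'.disjoint t with h2 | h2 <;>
      simp only [h1, h2, mul_zero, zero_add, add_zero] at e ⊢
    · exact (Nat.eq_zero_of_add_eq_zero_left e.symm).symm
    · exact Nat.eq_zero_of_add_eq_zero_right e
    · exact e
  have hηη : η = η' := by
    rcases le_total b c with hle | hle
    · refine (h'.eq_of_le h fun t => ?_).symm
      refine Nat.le_of_mul_le_mul_left ?_ hb
      rw [hη t]
      exact Nat.mul_le_mul_right _ hle
    · refine h.eq_of_le h' fun t => ?_
      refine Nat.le_of_mul_le_mul_left ?_ hc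
      rw [← hη t]
      exact Nat.mul_le_mul_right _ hle
  subst hηη
  obtain ⟨t, ht⟩ := Finsupp.ne_iff.1 h.lead_ne_zero
  have hbc' : b = c := Nat.eq_of_mul_eq_mul_right (Nat.pos_of_ne_zero ht) (hη t)
  subst hbc'
  have hθ : θ = θ' := by
    ext t
    have := hbc t
    refine Nat.eq_of_mul_eq_mul_left hb ?_
    omega
  subst hθ
  exact h.eq_of_exponents hα h'

/-- The monomial order makes the left side strictly larger. -/
theorem not_neg_collinear (h : IsBinomialRoot m α u p η θ l)
    (h' : IsBinomialRoot m α u p' η' θ' l') {b c : ℕ}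
    (hb : 0 < b) : ¬ ∀ t, b * η t + c * η' t = b * θ t + c * θ' t := by
  intro hbc
  have e : b • η + c • η' = b • θ + c • θ' := by
    ext t
    simpa using hbc t
  have e' := congrArg m.toSyn e
  rw [map_add, map_add, map_nsmul, map_nsmul, map_nsmul, map_nsmul] at e'
  refine (add_lt_add_of_lt_of_le ?_ ?_).ne' e'
  · exact nsmul_lt_nsmul_right hb.ne' h.lt
  · exact nsmul_le_nsmul_right h'.lt.le c

theorem independent_of_pos (hα : HasRealResidueField α.val α.real)
    (h : IsBinomialRoot m α u p η θ l) (h' : IsBinomialRoot m α u p' η' θ' l') (hne : p ≠ p')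
    {b c : ℤ} (hb : 0 < b)
    (hbc : ∀ t, b * ((η t : ℤ) - θ t) + c * ((η' t : ℤ) - θ' t) = 0) : False := by
  lift b to ℕ using hb.le
  rcases lt_or_ge c 0 with hc | hc
  · obtain ⟨d, rfl⟩ : ∃ d, c = -d := ⟨-c, by ring⟩
    lift d to ℕ using by omega
    refine hne (h.eq_of_pos_collinear hα h' (b := b) (c := d) (by omega) (by omega) fun t => ?_)
    have := hbc t
    zify
    linarith
  · lift c to ℕ using hc
    refine h.not_neg_collinear h' (b := b) (c := c) (by omega) fun t => ?_
    have := hbc t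
    zify
    linarith

theorem independent (hα : HasRealResidueField α.val α.real)
    (h : IsBinomialRoot m α u p η θ l) (h' : IsBinomialRoot m α u p' η' θ' l') (hne : p ≠ p')
    {b c : ℤ} (hbc : ∀ t, b * ((η t : ℤ) - θ t) + c * ((η' t : ℤ) - θ' t) = 0) :
    b = 0 := by
  rcases lt_trichotomy b 0 with hb | hb | hb
  · refine (h.independent_of_pos hα h' hne (b := -b) (c := -c) (by omega) fun t => ?_).elim
    have := hbc t
    linarith
  · exact hb
  · exact (h.independent_of_pos hα h' hne hb hbc).elim

/-- A parameter in the support of `p` may not vanish at `α`, since both monomials have finite value;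
parameters outside it may. -/
theorem eval_param_ne_zero (h : IsBinomialRoot m α u p η θ l) {t : Fin n}
    (ht : (η t : ℤ) - θ t ≠ 0) : α.eval (u t) ≠ 0 := by
  intro h0
  have key : ∀ δ : Fin n →₀ ℕ, α.v (genMonomial u δ) ≠ 0 → δ t = 0 := by
    intro δ hδ
    by_contra hne
    apply hδ
    rw [SperPoint.v_eq_zero_iff, genMonomial_eq_prod, map_prod]
    exact Finset.prod_eq_zero (Finset.mem_univ t) (by rw [map_pow, h0, zero_pow hne])
  exact ht (by rw [key η h.v_lead_ne_zero, key θ h.v_tail_ne_zero, sub_self])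

theorem prod_zpow_eq (h : IsBinomialRoot m α u p η θ l) :
    ∏ t, α.eval (u t) ^ ((η t : ℤ) - θ t) =
      α.eval (genMonomial u η) / α.eval (genMonomial u θ) := by
  have h0 : α.eval (genMonomial u θ) ≠ 0 := fun e =>
    h.v_tail_ne_zero ((SperPoint.v_eq_zero_iff _).2 e)
  rw [eq_div_iff h0, genMonomial_eq_prod, genMonomial_eq_prod, map_prod, map_prod,
    ← Finset.prod_mul_distrib]
  refine Finset.prod_congr rfl fun t _ => ?_
  rw [map_pow, map_pow, ← zpow_natCast, ← zpow_natCast]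
  -- Where `u t` may vanish at `α`, both exponents are zero, so powers of zero do no harm.
  rcases h.disjoint t with e | e
  · by_cases hu : α.eval (u t) = 0
    · have : (η t : ℤ) - θ t = 0 := by
        by_contra hne
        exact h.eval_param_ne_zero hne hu
      have hθ : θ t = 0 := by omega
      simp [e, hθ]
    · rw [← zpow_add₀ hu, sub_add_cancel]
  · simp [e]

theorem reducedRoot_eq (h : IsBinomialRoot m α u p η θ l) :
    α.real l + reducedRoot m α u p = ∏ t, α.eval (u t) ^ ((η t : ℤ) - θ t) := by
  have h0 : α.eval (genMonomial u θ) ≠ 0 := fun e =>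
    h.v_tail_ne_zero ((SperPoint.v_eq_zero_iff _).2 e)
  rw [reducedRoot, h.degree_subLTerm_eq, h.eval_aeval, h.prod_zpow_eq]
  field_simp
  ring

theorem val_reducedRoot_lt_one (h : IsBinomialRoot m α u p η θ l) :
    α.val (reducedRoot m α u p) < 1 := by
  rw [reducedRoot, h.degree_subLTerm_eq, map_div₀]
  change α.v (aeval u p) / α.v (genMonomial u θ) < 1
  rw [h.v_eq]
  exact (div_lt_one₀ (zero_lt_iff.2 h.v_lead_ne_zero)).2 h.jump

theorem reducedRoot_ne_zero (h : IsBinomialRoot m α u p η θ l) (h0 : α.eval (aeval u p) ≠ 0) :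
    reducedRoot m α u p ≠ 0 := by
  rw [reducedRoot, h.degree_subLTerm_eq]
  exact div_ne_zero h0 fun e => h.v_tail_ne_zero ((SperPoint.v_eq_zero_iff _).2 e)

theorem val_prod_zpow (h : IsBinomialRoot m α u p η θ l) :
    α.val (∏ t, α.eval (u t) ^ ((η t : ℤ) - θ t)) = 1 := by
  rw [h.prod_zpow_eq, map_div₀]
  change α.v (genMonomial u η) / α.v (genMonomial u θ) = 1
  rw [h.v_eq, div_self h.v_lead_ne_zero]

end IsBinomialRoot

/-! ### Multiplicative relations between Laurent monomials -/

theorem prod_zpow_of_ne_zero {K ι : Type*} [Field K] {x : K} (hx : x ≠ 0) (s : Finset ι)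
    (f : ι → ℤ) : ∏ i ∈ s, x ^ f i = x ^ ∑ i ∈ s, f i := by
  classical
  induction s using Finset.induction_on with
  | empty => simp
  | insert a s ha ih => rw [Finset.prod_insert ha, Finset.sum_insert ha, zpow_add₀ hx, ih]

/-- A linear combination of exponents corresponds to a product of powers of Laurent monomials. -/
theorem prod_zpow_monomials {K ι κ : Type*} [Field K] [Fintype ι] [Fintype κ] {x : κ → K}
    {W : Matrix ι κ ℤ} (hx : ∀ i t, W i t ≠ 0 → x t ≠ 0) (a : ι → ℤ) :
    ∏ i, (∏ t, x t ^ W i t) ^ a i = ∏ t, x t ^ (Matrix.vecMul a W t) := by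
  simp only [← Finset.prod_zpow, ← zpow_mul]
  rw [Finset.prod_comm]
  refine Finset.prod_congr rfl fun t _ => ?_
  by_cases h0 : x t = 0
  · have hW : ∀ i, W i t = 0 := fun i => by
      by_contra hne
      exact hx i t hne h0
    simp [Matrix.vecMul, dotProduct, hW]
  · rw [prod_zpow_of_ne_zero h0]
    congr 1
    simp only [Matrix.vecMul, dotProduct]
    exact Finset.sum_congr rfl fun i _ => mul_comm _ _

/-- Laurent monomials of value zero in parameters of positive value have dependent exponents. -/
theorem det_exponents_eq_zero {K Γ κ : Type*} [Field K] [LinearOrderedCommGroupWithZero Γ]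
    [Fintype κ] [DecidableEq κ] [Nonempty κ] (v : Valuation K Γ) {x : κ → K}
    (hx1 : ∀ t, v (x t) < 1) {W : Matrix κ κ ℤ} (hx : ∀ i t, W i t ≠ 0 → x t ≠ 0)
    (hW : ∀ i, v (∏ t, x t ^ W i t) = 1) : W.det = 0 := by
  by_contra hdet
  have hx0 : ∀ t, x t ≠ 0 := by
    intro t
    by_contra h0
    refine hdet (Matrix.det_eq_zero_of_column_eq_zero t fun i => ?_)
    by_contra hne
    exact hx i t hne h0
  obtain ⟨t⟩ := ‹Nonempty κ›
  -- Row `t` of the adjugate combines the rows of `W` into `det W` times the `t`-th unit vector, so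
  -- `x t ^ det W` has value `1`, against `v (x t) < 1`.
  have key := congrArg v (prod_zpow_monomials hx (W.adjugate t))
  have hrow : Matrix.vecMul (W.adjugate t) W = fun k => if k = t then W.det else 0 := by
    funext k
    have := congrFun (congrFun W.adjugate_mul t) k
    rw [Matrix.mul_apply] at this
    simp only [Matrix.vecMul, dotProduct]
    rw [this]
    simp [Matrix.one_apply, eq_comm]
  rw [hrow, map_prod] at key
  simp only [map_zpow₀, hW, one_zpow, Finset.prod_const_one] at key
  rw [Finset.prod_eq_single t (fun k _ hk => by simp [hk]) (by simp)] at key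
  simp only [if_true, map_zpow₀] at key
  have hpos : ∀ d : ℤ, 0 < d → v (x t) ^ d ≠ 1 := by
    intro d hd
    lift d to ℕ using hd.le
    rw [zpow_natCast]
    exact (pow_lt_one₀ zero_le (hx1 t) (by omega)).ne
  rcases lt_or_gt_of_ne hdet with hd | hd
  · refine hpos (-W.det) (by omega) ?_
    rw [zpow_neg, ← key, inv_one]
  · exact hpos _ hd key.symm

/-- If a coefficient of a nontrivial relation were zero, pairwise independence would force the other
two to vanish. -/
theorem exists_relation_of_pairwise_independent {W : Matrix (Fin 3) (Fin 3) ℤ} (hdet : W.det = 0)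
    (hind : ∀ i k, i ≠ k → ∀ b c : ℤ, (∀ t, b * W i t + c * W k t = 0) → b = 0) :
    ∃ a : Fin 3 → ℤ, (∀ i, a i ≠ 0) ∧ Matrix.vecMul a W = 0 := by
  obtain ⟨a, ha, hrel⟩ := Matrix.exists_vecMul_eq_zero_iff.2 hdet
  have hrel' : ∀ t, a 0 * W 0 t + a 1 * W 1 t + a 2 * W 2 t = 0 := by
    intro t
    have := congrFun hrel t
    simpa [Matrix.vecMul, dotProduct, Fin.sum_univ_three] using this
  have hzero : ¬ (a 0 = 0 ∧ a 1 = 0 ∧ a 2 = 0) := by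
    rintro ⟨h0, h1, h2⟩
    apply ha
    funext i
    fin_cases i <;> assumption
  refine ⟨a, fun i => ?_, hrel⟩
  fin_cases i <;> simp only [Fin.zero_eta, Fin.mk_one, Fin.reduceFinMk] <;> intro h0 <;>
    simp only [h0, zero_mul, zero_add, add_zero] at hrel'
  · exact hzero ⟨h0, hind 1 2 (by decide) _ _ hrel',
      hind 2 1 (by decide) _ _ fun t => (add_comm _ _).trans (hrel' t)⟩
  · exact hzero ⟨hind 0 2 (by decide) _ _ hrel', h0,
      hind 2 0 (by decide) _ _ fun t => (add_comm _ _).trans (hrel' t)⟩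
  · exact hzero ⟨hind 0 1 (by decide) _ _ hrel',
      hind 1 0 (by decide) _ _ fun t => (add_comm _ _).trans (hrel' t), h0⟩

/-- Comparability in terms of the leading coefficients of the reduced roots. -/
theorem comparable_iff {α β : SperPoint A} {u : Fin n → A} {p q : MvPolynomial (Fin n) ℝ}
    (hα : HasRealResidueField α.val α.real) (hβ : HasRealResidueField β.val β.real)
    {s : α.K} {a b : ℝ} {s' : β.K} {a' b' : ℝ}
    (hp : α.val (reducedRoot m α u p - α.real a * s) < α.val s)
    (hq : α.val (reducedRoot m α u q - α.real b * s) < α.val s)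
    (hp' : β.val (reducedRoot m β u p - β.real a' * s') < β.val s')
    (hq' : β.val (reducedRoot m β u q - β.real b' * s') < β.val s')
    (hab : a ≠ 0 ∨ b ≠ 0) (hab' : a' ≠ 0 ∨ b' ≠ 0) :
    Comparable m α β u p q ↔ a * b' = b * a' := by
  rw [← ratio_eq_iff hab hab', Comparable, hα.map_lt_map_iff hq hp hab.symm,
    hβ.map_lt_map_iff hq' hp' hab'.symm, hα.map_lt_map_iff hp hq hab,
    hβ.map_lt_map_iff hp' hq' hab']
  refine or_congr_right (or_congr_right ⟨?_, ?_⟩)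
  · rintro ⟨-, -, c, h1, h2⟩
    exact ⟨c, (hα.initial_ratio_iff c hp hq hab).1 h1, (hβ.initial_ratio_iff c hp' hq' hab').1 h2⟩
  · rintro ⟨c, h1, h2⟩
    have h1' := (hα.initial_ratio_iff c hp hq hab).2 h1
    have h2' := (hβ.initial_ratio_iff c hp' hq' hab').2 h2
    exact ⟨h1'.1, h2'.1, c, h1', h2'⟩

end Binomials

/-! ### The lemma on three common roots -/

theorem lemma6p6 {A : Type*} [CommRing A] [IsRegularLocalRing A] [Algebra ℝ A]
    (hdim : ringKrullDim A = 3)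
    (hres : Function.Bijective (algebraMap ℝ (IsLocalRing.ResidueField A)))
    (u : Fin 3 → A) (hu : Ideal.span (Set.range u) = IsLocalRing.maximalIdeal A)
    (m : MonomialOrder (Fin 3)) (α β : SperPoint A) (hα : α.IsCentered) (hβ : β.IsCentered)
    {γα : α.ValueGroup} {γβ : β.ValueGroup}
    (Sα : ApproximateRootSystem m α u γα) (Sβ : ApproximateRootSystem m β u γβ)
    (p : Fin 3 → MvPolynomial (Fin 3) ℝ) (hp : Function.Injective p)
    (hpα : ∀ i, Sα.IsComplexityOneRoot (p i))
    (hpβ : ∀ i, Sβ.IsComplexityOneRoot (p i))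
    (hsep : ∀ i, MvPolynomial.aeval u (p i) ∉ SperPoint.separatingIdeal α β) :
    (∀ i j, i ≠ j → Comparable m α β u (p i) (p j)) ∨
      (∀ i j, i ≠ j → ¬ Comparable m α β u (p i) (p j)) := by
  have rα := α.hasRealResidueField hres hα
  have rβ := β.hasRealResidueField hres hβ
  choose η θ l hroot using fun i => (hpα i).exists_isBinomialRoot rα
  have hroot' : ∀ i, IsBinomialRoot m β u (p i) (η i) (θ i) (l i) := by
    intro i
    obtain ⟨η', θ', l', h⟩ := (hpβ i).exists_isBinomialRoot rβ
    obtain ⟨rfl, rfl, rfl⟩ := (hroot i).unique h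
    exact h
  let W : Matrix (Fin 3) (Fin 3) ℤ := fun i t => (η i t : ℤ) - θ i t
  have hu1 : ∀ t, α.val (α.eval (u t)) < 1 := fun t =>
    (hα (u t)).2 (hu ▸ Ideal.subset_span ⟨t, rfl⟩)
  have hdet : W.det = 0 :=
    det_exponents_eq_zero α.val hu1 (fun i _ => (hroot i).eval_param_ne_zero)
      fun i => (hroot i).val_prod_zpow
  obtain ⟨a, ha, hrel⟩ := exists_relation_of_pairwise_independent hdet fun i k hik b c =>
    (hroot i).independent rα (hroot k) (hp.ne hik)
  -- The relation `a` involves only the exponents, so the same `a` serves both points.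
  have hprod : ∀ δ : SperPoint A, (∀ i, IsBinomialRoot m δ u (p i) (η i) (θ i) (l i)) →
      ∏ i, (δ.real (l i) + reducedRoot m δ u (p i)) ^ a i = 1 := by
    intro δ hδ
    have := prod_zpow_monomials (x := fun t => δ.eval (u t)) (W := W)
      (fun i _ => (hδ i).eval_param_ne_zero) a
    rw [hrel] at this
    simpa [(hδ _).reducedRoot_eq] using this
  have hne := fun i => SperPoint.eval_ne_zero_of_notMem_separatingIdeal (hsep i)
  have hl := fun i => (hroot i).ne_zero
  obtain ⟨s, r, hr, hs, hsum⟩ := rα.exists_orthogonal_coeffs hl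
    (fun i => (hroot i).reducedRoot_ne_zero (hne i).1)
    (fun i => (hroot i).val_reducedRoot_lt_one) (hprod α hroot)
  obtain ⟨s', r', hr', hs', hsum'⟩ := rβ.exists_orthogonal_coeffs hl
    (fun i => (hroot' i).reducedRoot_ne_zero (hne i).2)
    (fun i => (hroot' i).val_reducedRoot_lt_one) (hprod β hroot')
  have hb : ∀ i, (a i / l i : ℝ) ≠ 0 := fun i => div_ne_zero (Int.cast_ne_zero.2 (ha i)) (hl i)
  have hiff : ∀ i j, i ≠ j → (Comparable m α β u (p i) (p j) ↔ r i * r' j = r j * r' i) :=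
    fun i j hij => comparable_iff m rα rβ (hs i) (hs j) (hs' i) (hs' j)
      (coeff_ne_zero_or hb hr hsum hij) (coeff_ne_zero_or hb hr' hsum' hij)
  refine (minors_all_or_none hb hsum hsum').imp (fun h i j hij => ?_) fun h i j hij => ?_
  · exact (hiff i j hij).2 (h i j hij)
  · rw [hiff i j hij]
    exact h i j hij
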